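/- Consider the $T$-round single-pass streaming stochastic bandit problem with $n$ Bernoulli arms with means $\nu=(\mu_1,\dots,\mu_n)\in[0,1]^n$, arriving in this order. In each round the player may first discard stored arms and read any number of further arms from the stream, keeping at most $m$ arms in memory (an arm that is discarded or passed over never returns), and then pulls exactly one stored arm and observes its reward. The player may be randomized and may base each decision on everything observed so far. Let $A_t$ be the arm pulled in round $t$, $\mu_*=\max_i\mu_i$, $\Delta_i=\mu_*-\mu_i$, and $\mathbb E_\nu[R(T)]=\mathbb E_\nu\big[\sum_{t=1}^T(\mu_*-\mu_{A_t})\big]$. There is an absolute constant $c>0$ such that the following holds. Let $\alpha\ge 1$ be real, let $m,k,n$ be integers with $1\le m\le k<n$, and let $T\ge T_0$, where $T_0$ depends only on $\alpha,m,k,n$. Put $\varepsilon=\frac14\left(\frac kT\right)^{1/(2+2\alpha)}$ and consider the family of $2k$ instances, indexed by $i\in\{1,\dots,k\}$ and $b\in\{\frac12,1\}$, in which arm $1$ has mean $\frac12+n\varepsilon$, arm $i$ (if $i\ge 2$) has mean $\frac12+(n+1)\varepsilon$, every other arm among $2,\dots,k$ has mean $\frac12+(n-1)\varepsilon$, and each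 of the arms $k+1,\dots,n$ has mean $b$. Then for every such streaming algorithm with a memory of $m$ arms there is an instance $\nu$ in this family (with all means in $[0,1]$) on which $$\mathbb E_\nu[R(T)]\;\ge\; c\cdot 16^{-\alpha}\cdot\frac{(k-m+1)\,T^{\frac1{\alpha+1}}}{k^{1+\frac1{\alpha+1}}}\sum_{i:\Delta_i>0}\Delta_i^{1-2\alpha}.$$ -/

import Mathlib

namespace StreamingMAB

/-- A Bernoulli bandit instance with `n` arms: the vector of reward means.  Arms are indexed by
their position in the stream, so arm `0` arrives first and arm `n - 1` arrives last. -/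
abbrev Instance (n : ℕ) : Type := Fin n → unitInterval

/-- The largest reward mean of an instance. -/
noncomputable def bestMean {n : ℕ} (ν : Instance n) : ℝ := ⨆ i, (ν i : ℝ)

/-- The gap between the largest reward mean and the mean of arm `i`. -/
noncomputable def gap {n : ℕ} (ν : Instance n) (i : Fin n) : ℝ := bestMean ν - (ν i : ℝ)

/-- The Bernoulli distribution with mean `p`; the outcome `true` is reward `1`, and `false` is
reward `0`. -/
noncomputable def reward (p : unitInterval) : PMF Bool :=
  PMF.ofFintype
    (fun b => if b then ENNReal.ofReal (p : ℝ) else ENNReal.ofReal (1 - (p : ℝ)))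
    (by
      rw [Fintype.sum_bool]
      simp only [if_true, Bool.false_eq_true, if_false]
      rw [← ENNReal.ofReal_add p.2.1 (sub_nonneg.2 p.2.2)]
      simp)

/-- The storage of the player: how many arms of the stream have already gone by, and which arms
are currently kept in the memory. -/
structure Storage (n : ℕ) where
  arrived : Fin (n + 1)
  mem : Finset (Fin n)
deriving DecidableEq, Fintype

/-- What the player does in one round: the storage after discarding arms and reading new ones,
and the arm that is then pulled. -/
structure Decision (n : ℕ) where
  storage : Storage n
  pull : Fin n
deriving DecidableEq, Fintype

/-- One round of the game: the decision of the player and the reward that is observed. -/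
structure Round (n : ℕ) where
  decision : Decision n
  rew : Bool
deriving DecidableEq, Fintype

/-- The record of the first `t` rounds, in chronological order. -/
abbrev History (n t : ℕ) : Type := Fin t → Round n

/-- The storage before the first round: nothing has arrived and the memory is empty. -/
def initialStorage (n : ℕ) : Storage n := ⟨0, ∅⟩

/-- The storage at the end of a history. -/
def currentStorage {n : ℕ} : {t : ℕ} → History n t → Storage n
  | 0, _ => initialStorage n
  | t + 1, h => (h (Fin.last t)).decision.storage

/-- The single-pass rules with a memory of `m` arms.  The stream only moves forward; an arm in the
new memory was in the old memory, or it has just come in from the stream (so an arm that was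
discarded or passed over never returns); at most `m` arms are stored; the pulled arm is
stored.  Any number of arms may be read and discarded in one round. -/
structure ValidDecision {n : ℕ} (m : ℕ) (s : Storage n) (d : Decision n) : Prop where
  forward : (s.arrived : ℕ) ≤ (d.storage.arrived : ℕ)
  source : ∀ i ∈ d.storage.mem,
    i ∈ s.mem ∨ ((s.arrived : ℕ) ≤ (i : ℕ) ∧ (i : ℕ) < (d.storage.arrived : ℕ))
  card_le : d.storage.mem.card ≤ m
  pull_mem : d.pull ∈ d.storage.mem

/-- A history in which every round obeys the single-pass rules. -/
def ValidHistory {n : ℕ} (m : ℕ) : {t : ℕ} → History n t → Prop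
  | 0, _ => True
  | t + 1, h => ValidHistory m (Fin.init h) ∧
      ValidDecision m (currentStorage (Fin.init h)) (h (Fin.last t)).decision

/-- A (randomized) single-pass streaming algorithm on `n` arms with a memory of `m` arms: in each
round it draws its decision from a distribution that may depend on everything seen so far, and it
obeys the single-pass rules.  The memory bound concerns the stored arms; the algorithm is even
allowed to recall past observations of discarded arms. -/
structure Algorithm (m n : ℕ) where
  policy : (t : ℕ) → History n t → PMF (Decision n)
  valid : ∀ (t : ℕ) (h : History n t), ValidHistory m h →
    ∀ d ∈ (policy t h).support, ValidDecision m (currentStorage h) d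

/-- The distribution of the history of the first `t` rounds when the algorithm `A` is run on the
instance `ν`. -/
noncomputable def historyLaw {m n : ℕ} (A : Algorithm m n) (ν : Instance n) :
    (t : ℕ) → PMF (History n t)
  | 0 => PMF.pure Fin.elim0
  | t + 1 => (historyLaw A ν t).bind fun h =>
      (A.policy t h).bind fun d =>
        (reward (ν d.pull)).map fun r => Fin.snoc (α := fun _ => Round n) h ⟨d, r⟩

/-- The regret `∑ₜ (μ_* - μ_{Aₜ})` of a history. -/
noncomputable def regret {n : ℕ} (ν : Instance n) {T : ℕ} (h : History n T) : ℝ :=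
  ∑ t, gap ν (h t).decision.pull

/-- The expected regret after `T` rounds (an expectation over a finite sample space). -/
noncomputable def expectedRegret {m n : ℕ} (A : Algorithm m n) (ν : Instance n) (T : ℕ) : ℝ :=
  ∑ h : History n T, (historyLaw A ν T h).toReal * regret ν h

/-- `∑_{i : Δᵢ > 0} Δᵢ ^ (1 - 2 α)`. -/
noncomputable def gapSum {n : ℕ} (α : ℝ) (ν : Instance n) : ℝ :=
  ∑ i with 0 < gap ν i, gap ν i ^ (1 - 2 * α)

/-- The gap parameter `ε = (1 / 4) (k / T) ^ (1 / (2 + 2 α))` of the hard instances. -/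
noncomputable def hardEps (α : ℝ) (k T : ℕ) : ℝ :=
  1 / 4 * ((k : ℝ) / (T : ℝ)) ^ (1 / (2 + 2 * α))

/-- Means of a hard instance.  The first arm has mean `1/2 + n ε`, the other ones among the first
`k` arms have mean `1/2 + (n - 1) ε`, except that arm `i`, if it is not the first arm, has mean
`1/2 + (n + 1) ε`; the last `n - k` arms have mean `tail`. -/
noncomputable def hardMean (n k : ℕ) (ε tail : ℝ) (i : ℕ) (j : Fin n) : ℝ :=
  if (j : ℕ) < k then
    if (j : ℕ) = 0 then 1 / 2 + (n : ℝ) * ε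
    else if (j : ℕ) = i then 1 / 2 + ((n : ℝ) + 1) * ε
    else 1 / 2 + ((n : ℝ) - 1) * ε
  else tail

/-- The family of `2 k` hard instances: the special arm `i` ranges over the first `k` arms, and the
common mean of the last `n - k` arms is `1/2` or `1`. -/
def hardFamily (α : ℝ) (n k T : ℕ) : Set (Instance n) :=
  {ν | ∃ i < k, ∃ tail : ℝ, (tail = 1 / 2 ∨ tail = 1) ∧
    ∀ j, (ν j : ℝ) = hardMean n k (hardEps α k T) tail i j}

end StreamingMAB

namespace StreamingMAB

/-! Call leaving the first pull of an arm outside the first `k`. At that pull the memory holds at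
most `m - 1` of the first `k` arms and the stream has passed them all, so at least `r = k - m + 1`
of them are never pulled again (`exists_retained`, `le_card_abandoned`). Let `M` be the expected
number of rounds before leaving on the base instance `ν₀`, where arm `0` is best and the tail is
`1/2`.

If `M ≥ r / (200 ε²)`, let the tail be `1`. The behaviour before leaving is unchanged
(`mean_earlyRounds_congr`), and each such round now costs at least `1/4`.

If `M ≤ r / (200 ε²)`, raise one arm `i`. The relative entropy is at most `22 ε²` times the expected
early pulls of `i`, and these sum over `i` to `M`, so the total is a small multiple of `r`. A change
of measure (`half_mean_sub_mean_logRatio_le`) then shows that, for some `i`, the algorithm abandons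
arm `i` in the first half with probability at least `r / (8k)` even when `i` is best, and loses `ε`
in each of the remaining `T/2` rounds (`exists_le_expectedRegret`). Pulls of `i` after leaving must
not enter the entropy; hence the comparison with `switch`, which reverts to `ν₀` on leaving and
cannot be told from the raised instance if `i` is abandoned (`weight_switch`).

The choice of `ε` balances the two bounds against the respective gap sums. -/

variable {m n : ℕ}

/-! ### Probabilities and expectations of histories -/

/-- A mean-reward assignment that may depend on the past. -/
abbrev Environment (n : ℕ) : Type := (t : ℕ) → History n t → Fin n → unitInterval

/-- The environment in which the means are those of a fixed instance. -/
def stationary (ν : Instance n) : Environment n := fun _ _ j => ν j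

/-- The probability of the outcome `r` under the Bernoulli distribution with mean `p`. -/
def rewardProb (p : unitInterval) (r : Bool) : ℝ := if r then (p : ℝ) else 1 - (p : ℝ)

theorem rewardProb_nonneg (p : unitInterval) (r : Bool) : 0 ≤ rewardProb p r := by
  unfold rewardProb
  split_ifs
  · exact p.2.1
  · exact sub_nonneg.2 p.2.2

theorem sum_rewardProb (p : unitInterval) : ∑ r, rewardProb p r = 1 := by
  simp [rewardProb]

theorem toReal_reward (p : unitInterval) (r : Bool) :
    (reward p r).toReal = rewardProb p r := by
  unfold reward rewardProb
  rw [PMF.ofFintype_apply]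
  split_ifs
  · exact ENNReal.toReal_ofReal p.2.1
  · exact ENNReal.toReal_ofReal (sub_nonneg.2 p.2.2)

/-- The probability that a history arises when `A` is run in the environment `f`. -/
noncomputable def weight (A : Algorithm m n) (f : Environment n) : (t : ℕ) → History n t → ℝ
  | 0, _ => 1
  | t + 1, h => weight A f t (Fin.init h) *
      (A.policy t (Fin.init h) (h (Fin.last t)).decision).toReal *
      rewardProb (f t (Fin.init h) (h (Fin.last t)).decision.pull) (h (Fin.last t)).rew

/-- The history `h` followed by one more round. -/
def extend {t : ℕ} (h : History n t) (x : Round n) : History n (t + 1) :=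
  Fin.snoc (α := fun _ => Round n) h x

@[simp] theorem init_extend {t : ℕ} (h : History n t) (x : Round n) :
    (Fin.init (extend h x) : History n t) = h := by
  simp [extend]

@[simp] theorem extend_last {t : ℕ} (h : History n t) (x : Round n) :
    extend h x (Fin.last t) = x := by
  simp [extend]

theorem extend_init {t : ℕ} (h : History n (t + 1)) :
    extend (Fin.init h : History n t) (h (Fin.last t)) = h := by
  simp [extend]

theorem extend_inj {t : ℕ} {h h' : History n t} {x x' : Round n} :
    extend h x = extend h' x' ↔ h = h' ∧ x = x' := by
  constructor
  · intro e
    refine ⟨?_, ?_⟩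
    · have := congrArg (fun g : History n (t + 1) => (Fin.init g : History n t)) e
      simpa using this
    · have := congrFun e (Fin.last t)
      simpa using this
  · rintro ⟨rfl, rfl⟩
    rfl

/-- Histories of `t + 1` rounds, split into the first `t` rounds and the last one. -/
def extendEquiv (n t : ℕ) : History n t × Decision n × Bool ≃ History n (t + 1) where
  toFun p := extend p.1 ⟨p.2.1, p.2.2⟩
  invFun h := (Fin.init h, (h (Fin.last t)).decision, (h (Fin.last t)).rew)
  left_inv _ := by simp
  right_inv := extend_init

theorem sum_history_succ {t : ℕ} (F : History n (t + 1) → ℝ) :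
    ∑ h, F h = ∑ h : History n t, ∑ d : Decision n, ∑ r : Bool, F (extend h ⟨d, r⟩) := by
  rw [← (extendEquiv n t).sum_comp, Fintype.sum_prod_type]
  refine Finset.sum_congr rfl fun h _ => ?_
  rw [Fintype.sum_prod_type]
  rfl

theorem weight_extend (A : Algorithm m n) (f : Environment n) {t : ℕ} (h : History n t)
    (d : Decision n) (r : Bool) :
    weight A f (t + 1) (extend h ⟨d, r⟩) =
      weight A f t h * (A.policy t h d).toReal * rewardProb (f t h d.pull) r := by
  simp [weight]

theorem weight_nonneg (A : Algorithm m n) (f : Environment n) :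
    ∀ (t : ℕ) (h : History n t), 0 ≤ weight A f t h
  | 0, _ => zero_le_one
  | t + 1, _ => mul_nonneg (mul_nonneg (weight_nonneg A f t _) ENNReal.toReal_nonneg)
      (rewardProb_nonneg _ _)

theorem historyLaw_extend (A : Algorithm m n) (ν : Instance n) {t : ℕ} (h : History n t)
    (d : Decision n) (r : Bool) :
    historyLaw A ν (t + 1) (extend h ⟨d, r⟩) =
      historyLaw A ν t h * (A.policy t h d * reward (ν d.pull) r) := by
  have key : ∀ (h' : History n t) (d' : Decision n) (r' : Bool),
      (extend h ⟨d, r⟩ = Fin.snoc (α := fun _ => Round n) h' ⟨d', r'⟩) ↔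
        h = h' ∧ d = d' ∧ r = r' := by
    intro h' d' r'
    refine extend_inj.trans ?_
    simp
  simp only [historyLaw, PMF.bind_apply, PMF.map_apply, tsum_fintype, key]
  rw [Finset.sum_eq_single h, Finset.sum_eq_single d, Finset.sum_eq_single r]
  · simp
  · intro b _ hb
    simp [hb.symm]
  · simp
  · intro b _ hb
    simp [hb.symm]
  · simp
  · intro b _ hb
    simp [hb.symm]
  · simp

theorem toReal_historyLaw (A : Algorithm m n) (ν : Instance n) :
    ∀ (t : ℕ) (h : History n t), (historyLaw A ν t h).toReal = weight A (stationary ν) t h := by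
  intro t
  induction t with
  | zero =>
    intro h
    have : h = Fin.elim0 := Subsingleton.elim _ _
    simp [historyLaw, weight, this]
  | succ t ih =>
    intro h
    rw [← extend_init h]
    obtain ⟨d, r⟩ := h (Fin.last t)
    rw [historyLaw_extend, weight_extend, ENNReal.toReal_mul, ENNReal.toReal_mul, ih,
      toReal_reward, mul_assoc]
    rfl

/-- The expectation of `F` over the first `t` rounds. -/
noncomputable def mean (A : Algorithm m n) (f : Environment n) (t : ℕ) (F : History n t → ℝ) : ℝ :=
  ∑ h, weight A f t h * F h

theorem expectedRegret_eq_mean (A : Algorithm m n) (ν : Instance n) (T : ℕ) :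
    expectedRegret A ν T = mean A (stationary ν) T (regret ν) := by
  simp only [expectedRegret, mean, toReal_historyLaw]

theorem sum_policy (A : Algorithm m n) {t : ℕ} (h : History n t) :
    ∑ d, (A.policy t h d).toReal = 1 := by
  rw [← ENNReal.toReal_sum fun d _ => PMF.apply_ne_top _ _, ← tsum_fintype (L := .unconditional _),
    PMF.tsum_coe, ENNReal.toReal_one]

theorem mean_succ (A : Algorithm m n) (f : Environment n) {t : ℕ} (F : History n (t + 1) → ℝ) :
    mean A f (t + 1) F = mean A f t fun h => ∑ d, (A.policy t h d).toReal *
      ∑ r, rewardProb (f t h d.pull) r * F (extend h ⟨d, r⟩) := by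
  simp only [mean, sum_history_succ, weight_extend, Finset.mul_sum]
  refine Finset.sum_congr rfl fun h _ => Finset.sum_congr rfl fun d _ =>
    Finset.sum_congr rfl fun r _ => by ring

theorem mean_init (A : Algorithm m n) (f : Environment n) {t : ℕ} (F : History n t → ℝ) :
    mean A f (t + 1) (fun h => F (Fin.init h)) = mean A f t F := by
  rw [mean_succ]
  congr 1
  funext h
  simp only [init_extend, ← Finset.sum_mul, sum_rewardProb, one_mul, sum_policy]

theorem mean_add (A : Algorithm m n) (f : Environment n) (t : ℕ) (F G : History n t → ℝ) :
    mean A f t (fun h => F h + G h) = mean A f t F + mean A f t G := by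
  simp only [mean, mul_add, Finset.sum_add_distrib]

theorem mean_sub (A : Algorithm m n) (f : Environment n) (t : ℕ) (F G : History n t → ℝ) :
    mean A f t (fun h => F h - G h) = mean A f t F - mean A f t G := by
  simp only [mean, mul_sub, Finset.sum_sub_distrib]

theorem mean_const_mul (A : Algorithm m n) (f : Environment n) (t : ℕ) (a : ℝ)
    (F : History n t → ℝ) : mean A f t (fun h => a * F h) = a * mean A f t F := by
  simp only [mean, Finset.mul_sum, mul_left_comm]

theorem mean_finsetSum (A : Algorithm m n) (f : Environment n) (t : ℕ) {ι : Type*} (s : Finset ι)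
    (F : ι → History n t → ℝ) :
    mean A f t (fun h => ∑ i ∈ s, F i h) = ∑ i ∈ s, mean A f t (F i) := by
  simp only [mean, Finset.mul_sum]
  exact Finset.sum_comm

theorem mean_one (A : Algorithm m n) (f : Environment n) (t : ℕ) :
    mean A f t (fun _ => 1) = 1 := by
  induction t with
  | zero => simp [mean, weight]
  | succ t ih =>
    exact (mean_init A f fun _ => 1).trans ih

theorem validHistory_of_weight_ne_zero (A : Algorithm m n) (f : Environment n) :
    ∀ (t : ℕ) (h : History n t), weight A f t h ≠ 0 → ValidHistory m h
  | 0, _, _ => trivial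
  | t + 1, h, hw => by
    have hinit : ValidHistory m (Fin.init h : History n t) :=
      validHistory_of_weight_ne_zero A f t _ fun e => hw (by simp [weight, e])
    refine ⟨hinit, A.valid t _ hinit _ ?_⟩
    rw [PMF.mem_support_iff]
    intro e
    exact hw (by simp [weight, e])

/-- Histories that break the single-pass rules have weight zero, so the comparison is needed only on
valid ones; this is how the memory bound enters expectations. -/
theorem mean_mono (A : Algorithm m n) (f : Environment n) (t : ℕ) {F G : History n t → ℝ}
    (hFG : ∀ h, ValidHistory m h → F h ≤ G h) : mean A f t F ≤ mean A f t G := by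
  refine Finset.sum_le_sum fun h _ => ?_
  by_cases hw : weight A f t h = 0
  · simp [hw]
  · exact mul_le_mul_of_nonneg_left
      (hFG h (validHistory_of_weight_ne_zero A f t h hw)) (weight_nonneg A f t h)

theorem mean_nonpos_of_round_nonpos (A : Algorithm m n) (f : Environment n) {t : ℕ}
    {F : History n (t + 1) → ℝ}
    (hF : ∀ h d, ∑ r, rewardProb (f t h d.pull) r * F (extend h ⟨d, r⟩) ≤ 0) :
    mean A f (t + 1) F ≤ 0 := by
  rw [mean_succ]
  exact Finset.sum_nonpos fun h _ => mul_nonpos_of_nonneg_of_nonpos (weight_nonneg A f t h)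
    (Finset.sum_nonpos fun d _ => mul_nonpos_of_nonneg_of_nonpos ENNReal.toReal_nonneg (hF h d))

/-! ### Change of measure -/

/-- The log-likelihood ratio of a history between the environments `f` and `g`. -/
noncomputable def logRatio (f g : Environment n) : (t : ℕ) → History n t → ℝ
  | 0, _ => 0
  | t + 1, h => logRatio f g t (Fin.init h) +
      Real.log (rewardProb (f t (Fin.init h) (h (Fin.last t)).decision.pull) (h (Fin.last t)).rew /
        rewardProb (g t (Fin.init h) (h (Fin.last t)).decision.pull) (h (Fin.last t)).rew)

/-- In every situation, two environments have equal means or means strictly between `0` and `1`. -/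
def Comparable (f g : Environment n) : Prop :=
  ∀ t h j, f t h j = g t h j ∨
    (∀ r, 0 < rewardProb (f t h j) r) ∧ ∀ r, 0 < rewardProb (g t h j) r

/-- The policy factors of the two weights coincide, so only the reward factors contribute to the
ratio. -/
theorem weight_eq_mul_exp_neg_logRatio (A : Algorithm m n) {f g : Environment n}
    (hfg : Comparable f g) :
    ∀ (t : ℕ) (h : History n t), weight A g t h = weight A f t h * Real.exp (-logRatio f g t h)
  | 0, _ => by simp [weight, logRatio]
  | t + 1, h => by
    have step : ∀ j r, rewardProb (g t (Fin.init h) j) r = rewardProb (f t (Fin.init h) j) r *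
        Real.exp (-Real.log (rewardProb (f t (Fin.init h) j) r /
          rewardProb (g t (Fin.init h) j) r)) := by
      intro j r
      rcases hfg t (Fin.init h) j with e | ⟨hf, hg⟩
      · rw [e]
        by_cases h0 : rewardProb (g t (Fin.init h) j) r = 0
        · simp [h0]
        · simp [div_self h0]
      · rw [Real.exp_neg, Real.exp_log (div_pos (hf r) (hg r)), inv_div,
          mul_div_cancel₀ _ (hf r).ne']
    simp only [weight, logRatio]
    rw [weight_eq_mul_exp_neg_logRatio A hfg t, neg_add, Real.exp_add]
    linear_combination weight A f t (Fin.init h) * Real.exp (-logRatio f g t (Fin.init h)) *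
      (A.policy t (Fin.init h) (h (Fin.last t)).decision).toReal *
      step (h (Fin.last t)).decision.pull (h (Fin.last t)).rew

/-- A change of measure: an event that is likely in the environment `f` is likely in `g` as well, up
to the relative entropy. -/
theorem half_mean_sub_mean_logRatio_le (A : Algorithm m n) {f g : Environment n}
    (hfg : Comparable f g) (t : ℕ) (D : History n t → Prop) [DecidablePred D] :
    mean A f t (fun h => if D h then 1 else 0) / 2 - mean A f t (logRatio f g t) ≤
      mean A g t fun h => if D h then 1 else 0 := by
  have hf := mean_one A f t
  have hg := mean_one A g t
  -- A pointwise inequality suffices: the correction `weight g - weight f` sums to zero. With `l`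
  -- the log-ratio, it reads `2 exp (-l) ≥ 3/2 - l` on `D` and `exp (-l) ≥ 1 - l` off `D`.
  have key : ∀ h, weight A f t h * (if D h then 1 else 0) / 2 -
      weight A f t h * logRatio f g t h ≤
      weight A g t h * (if D h then 1 else 0) + (weight A g t h * 1 - weight A f t h * 1) := by
    intro h
    rw [weight_eq_mul_exp_neg_logRatio A hfg t h]
    have hw := weight_nonneg A f t h
    set l := logRatio f g t h
    split_ifs
    -- The shift by `log 2` gives `2 exp (-l) ≥ 1 + log 2 - l`, and `log 2 ≥ 1/2`.
    · have h1 := Real.add_one_le_exp (-l + Real.log 2)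
      rw [Real.exp_add, Real.exp_log two_pos] at h1
      have h2 := Real.log_two_gt_d9
      have h3 : 0 ≤ weight A f t h * (2 * Real.exp (-l) - 3 / 2 + l) :=
        mul_nonneg hw (by linarith)
      linarith
    · have h1 := Real.add_one_le_exp (-l)
      have h3 : 0 ≤ weight A f t h * (Real.exp (-l) - 1 + l) := mul_nonneg hw (by linarith)
      linarith
  have hsum := Finset.sum_le_sum fun h (_ : h ∈ Finset.univ) => key h
  simp only [Finset.sum_sub_distrib, Finset.sum_add_distrib, ← Finset.sum_div] at hsum
  simp only [mean] at hf hg ⊢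
  linarith

/-- The relative entropy of Bernoulli distributions is at most their chi-square divergence. -/
theorem sum_rewardProb_mul_log_le {p q : unitInterval} (hp : ∀ r, 0 < rewardProb p r)
    (hq : ∀ r, 0 < rewardProb q r) :
    ∑ r, rewardProb p r * Real.log (rewardProb p r / rewardProb q r) ≤
      ((p : ℝ) - q) ^ 2 / (q * (1 - q)) := by
  have hle : ∀ r, rewardProb p r * Real.log (rewardProb p r / rewardProb q r) ≤
      rewardProb p r * (rewardProb p r / rewardProb q r - 1) := fun r =>
    mul_le_mul_of_nonneg_left (Real.log_le_sub_one_of_pos (div_pos (hp r) (hq r))) (hp r).le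
  refine (Finset.sum_le_sum fun r _ => hle r).trans (le_of_eq ?_)
  have h0 : (q : ℝ) ≠ 0 := by simpa [rewardProb] using (hq true).ne'
  have h1 : 1 - (q : ℝ) ≠ 0 := by simpa [rewardProb] using (hq false).ne'
  simp only [Fintype.sum_bool, rewardProb, if_true, Bool.false_eq_true, if_false]
  field_simp
  ring

/-! ### Rounds before leaving the first arms -/

/-- All arms pulled in the history are among the first `k` arms. -/
def PullsBelow (k : ℕ) {t : ℕ} (h : History n t) : Prop :=
  ∀ s, ((h s).decision.pull : ℕ) < k

instance (k t : ℕ) : DecidablePred (PullsBelow (n := n) (t := t) k) := fun _ =>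
  inferInstanceAs (Decidable (∀ _, _))

theorem pullsBelow_succ {k t : ℕ} (h : History n (t + 1)) :
    PullsBelow k h ↔ PullsBelow k (Fin.init h : History n t) ∧
      ((h (Fin.last t)).decision.pull : ℕ) < k :=
  Fin.forall_fin_succ'

/-- The number of rounds before an arm outside the first `k` arms is pulled. -/
def earlyRounds (k : ℕ) : {t : ℕ} → History n t → ℕ
  | 0, _ => 0
  | t + 1, h => earlyRounds k (Fin.init h : History n t) + if PullsBelow k h then 1 else 0

/-- The number of pulls of arm `i` before an arm outside the first `k` arms is pulled. -/
def earlyPulls (k : ℕ) (i : Fin n) : {t : ℕ} → History n t → ℕ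
  | 0, _ => 0
  | t + 1, h => earlyPulls k i (Fin.init h : History n t) +
      if PullsBelow k h ∧ (h (Fin.last t)).decision.pull = i then 1 else 0

theorem sum_earlyPulls (k : ℕ) : ∀ {t : ℕ} (h : History n t),
    ∑ i ∈ {i : Fin n | (i : ℕ) < k}, earlyPulls k i h = earlyRounds k h
  | 0, _ => by simp [earlyPulls, earlyRounds]
  | t + 1, h => by
    simp only [earlyPulls, earlyRounds, Finset.sum_add_distrib]
    rw [sum_earlyPulls k]
    congr 1
    by_cases hb : PullsBelow k h
    · have : ((h (Fin.last t)).decision.pull : ℕ) < k := hb _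
      simp [hb, this]
    · simp [hb]

theorem earlyRounds_le (k : ℕ) : ∀ {t : ℕ} (h : History n t), earlyRounds k h ≤ t
  | 0, _ => le_rfl
  | t + 1, h => by
    have := earlyRounds_le k (Fin.init h : History n t)
    simp only [earlyRounds]
    split_ifs <;> omega

theorem earlyRounds_of_pullsBelow {k : ℕ} : ∀ {t : ℕ} {h : History n t},
    PullsBelow k h → earlyRounds k h = t
  | 0, _, _ => rfl
  | t + 1, h, hb => by
    rw [earlyRounds, if_pos hb, earlyRounds_of_pullsBelow ((pullsBelow_succ h).1 hb).1]

theorem earlyRounds_init {k t : ℕ} {h : History n (t + 1)} (hb : ¬ PullsBelow k h) :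
    earlyRounds k (Fin.init h : History n t) = earlyRounds k h := by
  simp [earlyRounds, hb]

/-- Arm `i` is not pulled any more once an arm outside the first `k` arms has been pulled. -/
def Abandoned (k : ℕ) (i : Fin n) {t : ℕ} (h : History n t) : Prop :=
  ∀ s : Fin t, earlyRounds k h ≤ s → (h s).decision.pull ≠ i

instance (k t : ℕ) (i : Fin n) : DecidablePred (Abandoned (t := t) k i) := fun _ =>
  inferInstanceAs (Decidable (∀ _, _))

theorem Abandoned.init {k t : ℕ} {i : Fin n} {h : History n (t + 1)} (hi : Abandoned k i h) :
    Abandoned k i (Fin.init h : History n t) := by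
  intro s hs
  by_cases hb : PullsBelow k h
  · rw [earlyRounds_of_pullsBelow ((pullsBelow_succ h).1 hb).1] at hs
    exact absurd hs (not_le.2 s.2)
  · rw [earlyRounds_init hb] at hs
    exact hi s.castSucc hs

theorem weight_eq_of_pullsBelow (A : Algorithm m n) {k : ℕ} {ν ν' : Instance n}
    (hν : ∀ j : Fin n, (j : ℕ) < k → ν j = ν' j) :
    ∀ (t : ℕ) (h : History n t), PullsBelow k h →
      weight A (stationary ν) t h = weight A (stationary ν') t h
  | 0, _, _ => rfl
  | t + 1, h, hb => by
    simp only [weight, stationary, hν _ (hb _)]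
    congr 2
    exact weight_eq_of_pullsBelow A hν t _ ((pullsBelow_succ h).1 hb).1

/-- What happens before the first pull outside the first `k` arms depends only on the means of
those arms. -/
theorem mean_earlyRounds_congr (A : Algorithm m n) {k : ℕ} {ν ν' : Instance n}
    (hν : ∀ j : Fin n, (j : ℕ) < k → ν j = ν' j) (t : ℕ) :
    mean A (stationary ν) t (fun h => (earlyRounds k h : ℝ)) =
      mean A (stationary ν') t fun h => (earlyRounds k h : ℝ) := by
  induction t with
  | zero => simp [mean, earlyRounds]
  | succ t ih =>
    simp only [earlyRounds, Nat.cast_add, mean_add]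
    rw [mean_init A _ fun h : History n t => (earlyRounds k h : ℝ),
      mean_init A _ fun h : History n t => (earlyRounds k h : ℝ), ih]
    congr 1
    refine Finset.sum_congr rfl fun h _ => ?_
    by_cases hb : PullsBelow k h
    · rw [weight_eq_of_pullsBelow A hν _ h hb]
    · simp [hb]

/-! ### The switched environment -/

/-- The environment that follows `ν` until an arm outside the first `k` arms is pulled, and `ν₀`
from then on. -/
def switch (k : ℕ) (ν ν₀ : Instance n) : Environment n :=
  fun _ h j => if PullsBelow k h then ν j else ν₀ j

/-- After leaving, only arms other than `i` are pulled, and on those `ν` and `ν₀` agree. -/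
theorem weight_switch (A : Algorithm m n) {k : ℕ} {i : Fin n} {ν ν₀ : Instance n}
    (hν : ∀ j, j ≠ i → ν j = ν₀ j) : ∀ (t : ℕ) (h : History n t), Abandoned k i h →
      weight A (switch k ν ν₀) t h = weight A (stationary ν) t h
  | 0, _, _ => rfl
  | t + 1, h, hi => by
    simp only [weight, stationary, switch]
    rw [weight_switch A hν t _ hi.init]
    congr 2
    split_ifs with hb
    · rfl
    · refine (hν _ (hi (Fin.last t) ?_)).symm
      rw [← earlyRounds_init fun h' => hb ((pullsBelow_succ h).1 h').1]
      exact earlyRounds_le k _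

/-- The relative entropy is at most the divergence at arm `i` times the number of early pulls. -/
theorem mean_logRatio_switch_le (A : Algorithm m n) {k : ℕ} {i : Fin n} {ν ν₀ : Instance n}
    (hi : (i : ℕ) < k) (hν : ∀ j, j ≠ i → ν j = ν₀ j) (h₀ : ∀ r, 0 < rewardProb (ν₀ i) r)
    (h₁ : ∀ r, 0 < rewardProb (ν i) r) (t : ℕ) :
    mean A (stationary ν₀) t (logRatio (stationary ν₀) (switch k ν ν₀) t) ≤
      ((ν₀ i : ℝ) - ν i) ^ 2 / (ν i * (1 - ν i)) *
        mean A (stationary ν₀) t fun h => (earlyPulls k i h : ℝ) := by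
  set a := ((ν₀ i : ℝ) - ν i) ^ 2 / (ν i * (1 - ν i))
  -- Valid also for outcomes of probability zero, since `0 / 0 = 0` and `Real.log 0 = 0`; arms other
  -- than `i` may have mean `0` or `1`.
  have hself : ∀ (p : unitInterval) (r : Bool),
      Real.log (rewardProb p r / rewardProb p r) = 0 := by
    intro p r
    by_cases h0 : rewardProb p r = 0
    · simp [h0]
    · simp [div_self h0]
  induction t with
  | zero => simp [mean, logRatio, earlyPulls]
  | succ t ih =>
    simp only [logRatio, earlyPulls, Nat.cast_add, mean_add]
    rw [mean_init A _ fun h : History n t => logRatio _ _ t h,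
      mean_init A _ fun h : History n t => (earlyPulls k i h : ℝ), mul_add]
    refine add_le_add ih ?_
    rw [← mean_const_mul, ← sub_nonpos, ← mean_sub]
    -- Condition on the past and the decision: the new log term vanishes unless arm `i` is pulled
    -- before leaving, and then its mean is a Bernoulli relative entropy.
    refine mean_nonpos_of_round_nonpos A _ fun h d => ?_
    simp only [init_extend, extend_last, pullsBelow_succ, stationary, switch]
    by_cases hb : PullsBelow k h
    · by_cases hd : d.pull = i
      · have := sum_rewardProb_mul_log_le h₀ h₁
        have hs := sum_rewardProb (ν₀ i)
        rw [Fintype.sum_bool] at this hs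
        simp only [hb, hd, hi, if_true, and_self, Nat.cast_one, mul_one, Fintype.sum_bool]
        have e : rewardProb (ν₀ i) true * a + rewardProb (ν₀ i) false * a = a := by
          rw [← add_mul, hs, one_mul]
        linarith
      · simp [hb, hd, hν _ hd, hself]
    · simp [hb, hself]

theorem comparable_switch {k : ℕ} {i : Fin n} {ν ν₀ : Instance n}
    (hν : ∀ j, j ≠ i → ν j = ν₀ j) (h₀ : ∀ r, 0 < rewardProb (ν₀ i) r)
    (h₁ : ∀ r, 0 < rewardProb (ν i) r) : Comparable (stationary ν₀) (switch k ν ν₀) := by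
  intro t h j
  by_cases hj : j = i
  · subst hj
    refine Or.inr ⟨h₀, fun r => ?_⟩
    unfold switch
    split_ifs
    · exact h₁ r
    · exact h₀ r
  · left
    simp [switch, stationary, hν j hj]

/-! ### The memory constraint -/

theorem mem_lt_arrived : ∀ {t : ℕ} {h : History n t}, ValidHistory m h →
    ∀ i ∈ (currentStorage h).mem, (i : ℕ) < ((currentStorage h).arrived : ℕ)
  | 0, _, _, i, hi => by simp [currentStorage, initialStorage] at hi
  | t + 1, h, ⟨hinit, hd⟩, i, hi => by
    rcases hd.source i hi with h1 | h1
    · exact (mem_lt_arrived hinit i h1).trans_le hd.forward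
    · exact h1.2

/-- Pulling an arm outside the first `k` arms leaves room for at most `m - 1` of those. -/
theorem exists_retained {k : ℕ} : ∀ {t : ℕ} {h : History n t}, ValidHistory m h →
    ¬ PullsBelow k h → k ≤ ((currentStorage h).arrived : ℕ) ∧
      ∃ s : Finset (Fin n), s.card + 1 ≤ m ∧ ∀ i : Fin n, (i : ℕ) < k →
        (i ∈ (currentStorage h).mem → i ∈ s) ∧ (¬ Abandoned k i h → i ∈ s)
  | 0, _, _, hb => absurd (fun s => s.elim0) hb
  | t + 1, h, hv, hb => by
    obtain ⟨hinit, hd⟩ := hv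
    have hC := earlyRounds_init hb
    have hlt := mem_lt_arrived (h := h) ⟨hinit, hd⟩
    by_cases hb' : PullsBelow k (Fin.init h : History n t)
    · have hpull : k ≤ ((h (Fin.last t)).decision.pull : ℕ) := by
        by_contra hc
        exact hb ((pullsBelow_succ h).2 ⟨hb', not_le.1 hc⟩)
      -- At the leaving round, the witness is the memory without the pulled tail arm, which occupies
      -- one of the `m` places.
      refine ⟨hpull.trans (hlt _ hd.pull_mem).le,
        (h (Fin.last t)).decision.storage.mem.erase (h (Fin.last t)).decision.pull, ?_, ?_⟩
      · rw [Finset.card_erase_add_one hd.pull_mem]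
        exact hd.card_le
      · intro i hi
        refine ⟨fun hmem => Finset.mem_erase.2 ⟨?_, hmem⟩, fun ha => absurd ?_ ha⟩
        · rintro rfl
          omega
        · intro s hs
          rw [← hC, earlyRounds_of_pullsBelow hb'] at hs
          have : s = Fin.last t := Fin.ext (by have := s.2; simp; omega)
          subst this
          intro e
          rw [e] at hpull
          omega
    · obtain ⟨hk, s, hs, hmem⟩ := exists_retained hinit hb'
      -- All of the first `k` arms have already gone by, so none can enter the memory anew.
      have hnew : ∀ i : Fin n, (i : ℕ) < k → i ∈ (currentStorage h).mem → i ∈ s := by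
        intro i hi hi'
        rcases hd.source i hi' with h1 | h1
        · exact (hmem i hi).1 h1
        · omega
      refine ⟨hk.trans hd.forward, s, hs, fun i hi => ⟨hnew i hi, fun ha => ?_⟩⟩
      by_contra his
      refine ha fun r => Fin.lastCases (fun _ e => ?_) (fun r hr => ?_) r
      · exact his (hnew i hi (e ▸ hd.pull_mem))
      · rw [← hC] at hr
        have : Abandoned k i (Fin.init h : History n t) := by
          by_contra hc
          exact his ((hmem i hi).2 hc)
        exact this r hr

theorem le_card_abandoned {k t : ℕ} (hk : k ≤ n) {h : History n t} (hv : ValidHistory m h)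
    (hb : ¬ PullsBelow k h) :
    k + 1 ≤ Finset.card {i : Fin n | (i : ℕ) < k ∧ Abandoned k i h} + m := by
  obtain ⟨-, s, hs, hmem⟩ := exists_retained hv hb
  have hcard : Finset.card {i : Fin n | (i : ℕ) < k} = k := by
    rw [Fin.card_filter_val_lt, min_eq_right hk]
  have hsub : ({i : Fin n | (i : ℕ) < k} : Finset (Fin n)) ⊆
      ({i : Fin n | (i : ℕ) < k ∧ Abandoned k i h} : Finset (Fin n)) ∪ s := by
    intro i hi
    simp only [Finset.mem_filter, Finset.mem_univ, true_and, Finset.mem_union] at hi ⊢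
    by_cases ha : Abandoned k i h
    · exact Or.inl ⟨hi, ha⟩
    · exact Or.inr ((hmem i hi).2 ha)
  have := (Finset.card_le_card hsub).trans (Finset.card_union_le _ _)
  omega

/-! ### Gaps and pathwise regret -/

theorem le_bestMean (ν : Instance n) (i : Fin n) : (ν i : ℝ) ≤ bestMean ν :=
  le_ciSup (f := fun j => (ν j : ℝ)) (Set.finite_range _).bddAbove i

theorem gap_nonneg (ν : Instance n) (i : Fin n) : 0 ≤ gap ν i :=
  sub_nonneg.2 (le_bestMean ν i)

theorem sub_le_gap (ν : Instance n) (i j : Fin n) : (ν i : ℝ) - ν j ≤ gap ν j :=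
  sub_le_sub_right (le_bestMean ν i) _

theorem gap_eq_zero {ν : Instance n} {i : Fin n} (hi : ∀ j, (ν j : ℝ) ≤ ν i) : gap ν i = 0 := by
  have : Nonempty (Fin n) := ⟨i⟩
  exact sub_eq_zero.2 (le_antisymm (ciSup_le hi) (le_bestMean ν i))

theorem mul_earlyRounds_le_regret {k : ℕ} {ν : Instance n} {a : ℝ}
    (hν : ∀ j : Fin n, (j : ℕ) < k → a ≤ gap ν j) :
    ∀ {t : ℕ} (h : History n t), a * earlyRounds k h ≤ regret ν h
  | 0, _ => by simp [earlyRounds, regret]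
  | t + 1, h => by
    have ih := mul_earlyRounds_le_regret hν (Fin.init h : History n t)
    have hlast : a * ((if PullsBelow k h then 1 else 0 : ℕ) : ℝ) ≤
        gap ν (h (Fin.last t)).decision.pull := by
      split_ifs with hb
      · simpa using hν _ (hb _)
      · simpa using gap_nonneg ν _
    simp only [regret, Fin.sum_univ_castSucc, earlyRounds, Nat.cast_add, mul_add] at ih ⊢
    exact add_le_add ih hlast

theorem mul_sub_earlyRounds_le_regret {k : ℕ} {i : Fin n} {ν : Instance n} {a : ℝ}
    (hν : ∀ j, j ≠ i → a ≤ gap ν j) {t : ℕ} {h : History n t} (hi : Abandoned k i h) :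
    a * (t - earlyRounds k h) ≤ regret ν h := by
  have hC := earlyRounds_le k h
  have hcard : Finset.card {s : Fin t | earlyRounds k h ≤ s} = t - earlyRounds k h := by
    have h1 := Finset.card_filter_add_card_filter_not
      (s := (Finset.univ : Finset (Fin t))) fun s : Fin t => (s : ℕ) < earlyRounds k h
    rw [Fin.card_filter_val_lt, min_eq_right hC, Finset.card_fin] at h1
    simp only [not_lt] at h1
    omega
  calc a * (t - earlyRounds k h)
      = ∑ s ∈ {s : Fin t | earlyRounds k h ≤ s}, a := by
        rw [Finset.sum_const, hcard, nsmul_eq_mul, Nat.cast_sub hC, mul_comm]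
    _ ≤ ∑ s ∈ {s : Fin t | earlyRounds k h ≤ s}, gap ν (h s).decision.pull :=
        Finset.sum_le_sum fun s hs => hν _ (hi s (Finset.mem_filter.1 hs).2)
    _ ≤ regret ν h :=
        Finset.sum_le_sum_of_subset_of_nonneg (Finset.filter_subset _ _)
          fun s _ _ => gap_nonneg ν _

/-! ### Regret caused by leaving early -/

/-- Leaving the first `k` arms early makes the algorithm abandon the best arm in one of the instances
`ν i`. -/
theorem exists_le_expectedRegret (A : Algorithm m n) {k T : ℕ} (hm : 1 ≤ m) (hmk : m ≤ k)
    (hkn : k ≤ n) {ε : ℝ} (hε : 0 < ε) (ν₀ : Instance n) (ν : Fin n → Instance n)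
    (hν : ∀ i j, j ≠ i → ν i j = ν₀ j)
    (h₀ : ∀ i : Fin n, (i : ℕ) < k → (ν₀ i : ℝ) ∈ Set.Icc (1 / 4 : ℝ) (3 / 4))
    (h₁ : ∀ i : Fin n, (i : ℕ) < k → (ν i i : ℝ) ∈ Set.Icc (1 / 4 : ℝ) (3 / 4))
    (hdist : ∀ i : Fin n, (i : ℕ) < k → |(ν₀ i : ℝ) - ν i i| ≤ 2 * ε)
    (hgap : ∀ i j : Fin n, (i : ℕ) < k → j ≠ i → ε ≤ gap (ν i) j) (hT : (k : ℝ) ≤ ε ^ 2 * T)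
    (hM : mean A (stationary ν₀) T (fun h => (earlyRounds k h : ℝ)) ≤
      ((k : ℝ) - m + 1) / (200 * ε ^ 2)) :
    ∃ i : Fin n, (i : ℕ) < k ∧
      ε * T * ((k : ℝ) - m + 1) / (16 * k) ≤ expectedRegret A (ν i) T := by
  set r : ℝ := (k : ℝ) - m + 1 with hr
  set M := mean A (stationary ν₀) T fun h => (earlyRounds k h : ℝ) with hMdef
  have hk1 : (1 : ℝ) ≤ k := by exact_mod_cast hm.trans hmk
  have hm1 : (1 : ℝ) ≤ m := by exact_mod_cast hm
  have hmk' : (m : ℝ) ≤ k := by exact_mod_cast hmk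
  have hr1 : 1 ≤ r := by linarith
  have hrk : r ≤ k := by linarith
  have hε2 : 0 < ε ^ 2 := by positivity
  have hTpos : (0 : ℝ) < T := by
    by_contra hc
    nlinarith
  -- `Abandoned` alone is vacuously true if the algorithm never leaves; the second condition forces
  -- leaving and keeps at least half of the rounds for the loss.
  let D : Fin n → History n T → Prop := fun i h => Abandoned k i h ∧ 2 * earlyRounds k h ≤ T
  let I : Finset (Fin n) := {i : Fin n | (i : ℕ) < k}
  have hIcard : I.card = k := by rw [Fin.card_filter_val_lt, min_eq_right hkn]
  -- Markov's inequality, applied pathwise: at least `r` arms are abandoned when leaving occurs in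
  -- the first half, and otherwise `1 - 2 * earlyRounds / T` is negative.
  have hmany : r * (1 - 2 / T * M) ≤
      ∑ i ∈ I, mean A (stationary ν₀) T fun h => if D i h then 1 else 0 := by
    have e : r * (1 - 2 / T * M) = mean A (stationary ν₀) T fun h =>
        r * (1 - 2 / T * (earlyRounds k h : ℝ)) := by
      rw [mean_const_mul, mean_sub, mean_const_mul, mean_one]
    rw [e, ← mean_finsetSum]
    refine mean_mono A _ T fun h hv => ?_
    by_cases hC : 2 * earlyRounds k h ≤ T
    · have hb : ¬ PullsBelow k h := by
        intro hb
        rw [earlyRounds_of_pullsBelow hb] at hC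
        have : 0 < T := by exact_mod_cast hTpos
        omega
      have hcard := le_card_abandoned hkn hv hb
      have hcard' : (k : ℝ) + 1 ≤ Finset.card {i : Fin n | (i : ℕ) < k ∧ Abandoned k i h} + m := by
        exact_mod_cast hcard
      simp only [D, hC, and_true, Finset.sum_boole, I, Finset.filter_filter]
      have : 0 ≤ r * (2 / T * (earlyRounds k h : ℝ)) := by positivity
      linarith
    · have hC' : (T : ℝ) < 2 * earlyRounds k h := by exact_mod_cast not_le.1 hC
      have h1 : 1 - 2 / T * (earlyRounds k h : ℝ) ≤ 0 := by
        rw [div_mul_eq_mul_div, sub_nonpos, le_div_iff₀ hTpos]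
        linarith
      refine (mul_nonpos_of_nonneg_of_nonpos (by linarith) h1).trans
        (Finset.sum_nonneg fun i _ => ?_)
      split_ifs <;> simp
  have htransfer : ∀ i ∈ I, (mean A (stationary ν₀) T fun h => if D i h then 1 else 0) / 2 -
      22 * ε ^ 2 * (mean A (stationary ν₀) T fun h => (earlyPulls k i h : ℝ)) ≤
      mean A (stationary (ν i)) T fun h => if D i h then 1 else 0 := by
    intro i hi
    have hik : (i : ℕ) < k := (Finset.mem_filter.1 hi).2
    have hpos : ∀ p : unitInterval, (p : ℝ) ∈ Set.Icc (1 / 4 : ℝ) (3 / 4) →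
        ∀ r, 0 < rewardProb p r := by
      intro p hp r
      unfold rewardProb
      split_ifs <;> linarith [hp.1, hp.2]
    have hp₀ := hpos _ (h₀ i hik)
    have hp₁ := hpos _ (h₁ i hik)
    have hKL := mean_logRatio_switch_le A hik (hν i) hp₀ hp₁ T
    have hN : 0 ≤ mean A (stationary ν₀) T fun h => (earlyPulls k i h : ℝ) :=
      Finset.sum_nonneg fun h _ => mul_nonneg (weight_nonneg A _ T h) (Nat.cast_nonneg _)
    -- On `[1/4, 3/4]` the variance is at least `3/16`, and `4 / (3/16) = 64/3 ≤ 22`.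
    have hdiv : ((ν₀ i : ℝ) - ν i i) ^ 2 / (ν i i * (1 - ν i i)) ≤ 22 * ε ^ 2 := by
      obtain ⟨hl, hu⟩ := h₁ i hik
      have hq : 3 / 16 ≤ (ν i i : ℝ) * (1 - ν i i) := by nlinarith
      have hsq : ((ν₀ i : ℝ) - ν i i) ^ 2 ≤ (2 * ε) ^ 2 := sq_le_sq' (by
        linarith [neg_abs_le ((ν₀ i : ℝ) - ν i i), hdist i hik])
        ((le_abs_self _).trans (hdist i hik))
      rw [div_le_iff₀ (by linarith)]
      nlinarith
    have hchange := half_mean_sub_mean_logRatio_le A (comparable_switch (k := k) (hν i) hp₀ hp₁) T (D i)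
    have hswitch : (mean A (switch k (ν i) ν₀) T fun h => if D i h then 1 else 0) =
        mean A (stationary (ν i)) T fun h => if D i h then 1 else 0 := by
      refine Finset.sum_congr rfl fun h _ => ?_
      by_cases hD : D i h
      · rw [weight_switch A (hν i) T h hD.1]
      · simp [hD]
    rw [hswitch] at hchange
    linarith [mul_le_mul_of_nonneg_right hdiv hN]
  have hpulls : ∑ i ∈ I, (mean A (stationary ν₀) T fun h => (earlyPulls k i h : ℝ)) = M := by
    rw [← mean_finsetSum, hMdef]
    congr 1
    funext h
    exact_mod_cast sum_earlyPulls k h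
  have hεM : ε ^ 2 * M ≤ r / 200 := by
    have := mul_le_mul_of_nonneg_left hM hε2.le
    refine this.trans (le_of_eq ?_)
    field_simp
  have hMT : 2 / T * M ≤ 1 / 100 := by
    rw [div_mul_eq_mul_div, div_le_iff₀ hTpos]
    have h1 : ε ^ 2 * M ≤ ε ^ 2 * (T / 200) := by linarith
    have := le_of_mul_le_mul_left h1 hε2
    linarith
  have hsum : ∑ i ∈ I, r / (8 * k) ≤
      ∑ i ∈ I, mean A (stationary (ν i)) T fun h => if D i h then 1 else 0 := by
    -- Numerically, `(99/100) / 2 - 22/200 = 0.385`, which exceeds `1/8`.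
    have h1 := Finset.sum_le_sum htransfer
    rw [Finset.sum_sub_distrib, ← Finset.sum_div, ← Finset.mul_sum, hpulls] at h1
    have h2 : r * (99 / 100) ≤ r * (1 - 2 / T * M) :=
      mul_le_mul_of_nonneg_left (by linarith) (by linarith)
    have h3 : ∑ i ∈ I, r / (8 * k) = r / 8 := by
      rw [Finset.sum_const, hIcard, nsmul_eq_mul]
      field_simp
    linarith
  have hI : I.Nonempty := Finset.card_pos.1 (by omega)
  obtain ⟨i, hi, hle⟩ := Finset.exists_le_of_sum_le hI hsum
  have hik : (i : ℕ) < k := (Finset.mem_filter.1 hi).2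
  refine ⟨i, hik, ?_⟩
  have hregret : ε * T / 2 * (mean A (stationary (ν i)) T fun h => if D i h then 1 else 0) ≤
      expectedRegret A (ν i) T := by
    rw [expectedRegret_eq_mean, ← mean_const_mul]
    refine mean_mono A _ T fun h _ => ?_
    split_ifs with hD
    · have h1 := mul_sub_earlyRounds_le_regret (fun j => hgap i j hik) hD.1
      have h2 : 2 * (earlyRounds k h : ℝ) ≤ T := by exact_mod_cast hD.2
      nlinarith
    · rw [mul_zero]
      exact Finset.sum_nonneg fun s _ => gap_nonneg _ _
  have := mul_le_mul_of_nonneg_left hle (by positivity : 0 ≤ ε * T / 2)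
  calc ε * T * r / (16 * k) = ε * T / 2 * (r / (8 * k)) := by field_simp; norm_num
    _ ≤ _ := this.trans hregret

/-! ### Gap sums of the hard instances -/

theorem gapSum_le_sum {α : ℝ} {ν : Instance n} {u : Fin n → ℝ} (hu : ∀ j, 0 ≤ u j)
    (h : ∀ j, 0 < gap ν j → gap ν j ^ (1 - 2 * α) ≤ u j) : gapSum α ν ≤ ∑ j, u j :=
  (Finset.sum_le_sum fun j hj => h j (Finset.mem_filter.1 hj).2).trans
    (Finset.sum_le_sum_of_subset_of_nonneg (Finset.filter_subset _ _) fun j _ _ => hu j)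

theorem sum_ite_val_lt {k : ℕ} (hk : k ≤ n) (a : ℝ) :
    ∑ j : Fin n, (if (j : ℕ) < k then a else 0) = k * a := by
  rw [← Finset.sum_filter, Finset.sum_const, Fin.card_filter_val_lt, min_eq_right hk, nsmul_eq_mul]

/-- The hard instance with the given parameters, for means in the unit interval. -/
noncomputable def hardInstance (n k : ℕ) (ε tail : ℝ) (i : ℕ) : Instance n := fun j =>
  Set.projIcc 0 1 zero_le_one (hardMean n k ε tail i j)

theorem coe_hardInstance {k : ℕ} {ε tail : ℝ} (hε : 0 < ε) (hnε : (n + 1) * ε ≤ 1 / 8)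
    (htail : tail = 1 / 2 ∨ tail = 1) (i : ℕ) (j : Fin n) :
    (hardInstance n k ε tail i j : ℝ) = hardMean n k ε tail i j := by
  have hn : (1 : ℝ) ≤ n := by exact_mod_cast j.pos
  have h1 : ε ≤ n * ε := le_mul_of_one_le_left hε.le hn
  have hmem : hardMean n k ε tail i j ∈ Set.Icc (0 : ℝ) 1 := by
    unfold hardMean
    split_ifs
    · constructor <;> linarith
    · constructor <;> linarith
    · constructor <;> linarith
    · rcases htail with rfl | rfl <;> norm_num
  unfold hardInstance
  rw [Set.projIcc_of_mem _ hmem]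

theorem gapSum_hardInstance_one_le {α : ℝ} (hα : 1 ≤ α) {k : ℕ} (hkn : k < n) {ε : ℝ} (hε : 0 < ε)
    (hnε : (n + 1) * ε ≤ 1 / 8) (i : ℕ) :
    (∀ j : Fin n, (j : ℕ) < k → 1 / 4 ≤ gap (hardInstance n k ε 1 i) j) ∧
      gapSum α (hardInstance n k ε 1 i) ≤ k * (1 / 4 : ℝ) ^ (1 - 2 * α) := by
  have hn : (1 : ℝ) ≤ n := by exact_mod_cast (Nat.zero_le k).trans_lt hkn
  have h1 : ε ≤ n * ε := le_mul_of_one_le_left hε.le hn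
  have hgap : ∀ j : Fin n, (j : ℕ) < k → 1 / 4 ≤ gap (hardInstance n k ε 1 i) j := by
    intro j hj
    refine le_trans ?_ (sub_le_gap _ ⟨k, hkn⟩ j)
    rw [coe_hardInstance hε hnε (Or.inr rfl), coe_hardInstance hε hnε (Or.inr rfl)]
    simp only [hardMean, lt_irrefl, if_false, hj, if_true]
    split_ifs <;> linarith
  refine ⟨hgap, ?_⟩
  rw [← sum_ite_val_lt hkn.le]
  refine gapSum_le_sum (fun j => ?_) fun j hj => ?_
  · split_ifs <;> positivity
  · split_ifs with hjk
    · exact Real.rpow_le_rpow_of_nonpos (by norm_num) (hgap j hjk) (by linarith)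
    · refine absurd (gap_eq_zero fun j' => ?_) hj.ne'
      have : (hardInstance n k ε 1 i j : ℝ) = 1 := by
        rw [coe_hardInstance hε hnε (Or.inr rfl)]
        simp [hardMean, hjk]
      rw [this]
      exact (hardInstance n k ε 1 i j').2.2

theorem gap_hardInstance_half {k : ℕ} {ε : ℝ} (hε : 0 < ε) (hnε : (n + 1) * ε ≤ 1 / 8) {i : Fin n}
    (hik : (i : ℕ) < k) {j : Fin n} (hj : j ≠ i) :
    (if (j : ℕ) < k then ε else n * ε) ≤ gap (hardInstance n k ε (1 / 2) i) j := by
  have hj' : (j : ℕ) ≠ i := fun e => hj (Fin.ext e)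
  refine le_trans ?_ (sub_le_gap _ i j)
  rw [coe_hardInstance hε hnε (Or.inl rfl), coe_hardInstance hε hnε (Or.inl rfl)]
  simp only [hardMean, hik, if_true, hj', if_false]
  split_ifs <;> first | linarith | omega

/-- Tail arms have gap at least `n ε`, and `1 - 2 α ≤ -1`, so each contributes at most `ε ^ (1 - 2
α) / n`. Together they cost at most one term `ε ^ (1 - 2 α)`, which fits in the slot left empty by
the best arm. This is why the means are raised by multiples of `ε` of order `n`. -/
theorem gapSum_hardInstance_half_le {α : ℝ} (hα : 1 ≤ α) {k : ℕ} (hkn : k ≤ n) {ε : ℝ} (hε : 0 < ε)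
    (hnε : (n + 1) * ε ≤ 1 / 8) {i : Fin n} (hik : (i : ℕ) < k) :
    gapSum α (hardInstance n k ε (1 / 2) i) ≤ k * ε ^ (1 - 2 * α) := by
  have hn : (1 : ℝ) ≤ n := by exact_mod_cast i.pos
  have hE : 0 < ε ^ (1 - 2 * α) := by positivity
  have hEn : 0 < ε ^ (1 - 2 * α) / n := by positivity
  have h1 : ε ≤ n * ε := le_mul_of_one_le_left hε.le hn
  have htotal : ∑ j : Fin n, ((if (j : ℕ) < k then ε ^ (1 - 2 * α) else 0) +
      ε ^ (1 - 2 * α) / n - if j = i then ε ^ (1 - 2 * α) else 0) = k * ε ^ (1 - 2 * α) := by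
    rw [Finset.sum_sub_distrib, Finset.sum_add_distrib, sum_ite_val_lt hkn, Finset.sum_ite_eq']
    simp only [Finset.mem_univ, if_true, Finset.sum_const, Finset.card_fin, nsmul_eq_mul]
    field_simp
    ring
  rw [← htotal]
  refine gapSum_le_sum (fun j => ?_) fun j hj => ?_
  · by_cases hji : j = i
    · simp only [hji, hik, if_true]
      linarith
    · simp only [hji, if_false]
      split_ifs <;> linarith
  · by_cases hji : j = i
    · refine absurd (gap_eq_zero fun j' => ?_) hj.ne'
      subst hji
      rw [coe_hardInstance hε hnε (Or.inl rfl), coe_hardInstance hε hnε (Or.inl rfl)]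
      simp only [hardMean, hik, if_true]
      split_ifs <;> first | linarith | omega
    · have hg := gap_hardInstance_half hε hnε hik hji
      simp only [hji, if_false]
      split_ifs at hg ⊢ with hjk
      · have := Real.rpow_le_rpow_of_nonpos hε hg (by linarith : 1 - 2 * α ≤ 0)
        linarith
      · have h2 := Real.rpow_le_rpow_of_nonpos (by positivity) hg (by linarith : 1 - 2 * α ≤ 0)
        rw [Real.mul_rpow (by positivity) hε.le] at h2
        have h3 : (n : ℝ) ^ (1 - 2 * α) ≤ (n : ℝ)⁻¹ := by
          rw [← Real.rpow_neg_one]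
          exact Real.rpow_le_rpow_of_exponent_le hn (by linarith)
        have h4 := mul_le_mul_of_nonneg_right h3 hE.le
        rw [div_eq_inv_mul (ε ^ (1 - 2 * α))]
        linarith

/-! ### Identities for the gap parameter -/

theorem hardEps_pos {α : ℝ} {k T : ℕ} (hk : 0 < k) (hT : 0 < T) : 0 < hardEps α k T := by
  unfold hardEps
  positivity

theorem rpow_div_rpow_eq {α : ℝ} (hα : 0 < α) {k T : ℕ} (hk : 0 < k) (hT : 0 < T) :
    (T : ℝ) ^ (1 / (α + 1)) / (k : ℝ) ^ (1 + 1 / (α + 1)) = 1 / (16 * k * hardEps α k T ^ 2) := by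
  have hk' : (0 : ℝ) < k := by exact_mod_cast hk
  have hT' : (0 : ℝ) < T := by exact_mod_cast hT
  have hsq : 16 * hardEps α k T ^ 2 = (k : ℝ) ^ (1 / (α + 1)) / (T : ℝ) ^ (1 / (α + 1)) := by
    unfold hardEps
    rw [mul_pow, ← Real.rpow_mul_natCast (by positivity), ← Real.div_rpow hk'.le hT'.le]
    have : 1 / (2 + 2 * α) * ((2 : ℕ) : ℝ) = 1 / (α + 1) := by
      push_cast
      field_simp
      ring
    rw [this]
    ring
  rw [mul_right_comm, hsq, Real.rpow_add hk', Real.rpow_one]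
  field_simp

/-- A rewriting of `(4 ε) ^ (2 + 2 α) = k / T`; it turns the gap sum of the instances with tail
`1/2` into the regret scale `ε T`. -/
theorem sixteen_rpow_mul_hardEps_rpow {α : ℝ} (hα : 0 < α) {k T : ℕ} (hk : 0 < k) (hT : 0 < T) :
    (16 : ℝ) ^ (-α) * hardEps α k T ^ (1 - 2 * α) = 16 * hardEps α k T ^ 3 * T / k := by
  have hk' : (0 : ℝ) < k := by exact_mod_cast hk
  have hT' : (0 : ℝ) < T := by exact_mod_cast hT
  have hε := hardEps_pos (α := α) hk hT
  have hpow : (4 * hardEps α k T) ^ (2 + 2 * α) = k / T := by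
    unfold hardEps
    rw [← mul_assoc, show (4 : ℝ) * (1 / 4) = 1 by norm_num, one_mul,
      ← Real.rpow_mul (by positivity), one_div_mul_cancel (by positivity), Real.rpow_one]
  generalize hardEps α k T = ε at hε hpow ⊢
  rw [Real.mul_rpow (by norm_num) hε.le, Real.rpow_add (by norm_num), Real.rpow_mul (by norm_num),
    show ((4 : ℝ) ^ (2 : ℝ)) = 16 by norm_num] at hpow
  have hsplit : ε ^ (1 - 2 * α) * ε ^ (2 + 2 * α) = ε ^ 3 := by
    rw [← Real.rpow_add hε, ← Real.rpow_natCast]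
    congr 1
    push_cast
    ring
  have hA : (16 : ℝ) ^ (-α) * 16 ^ α = 1 := by
    rw [← Real.rpow_add (by norm_num)]
    simp
  have hTk : (T : ℝ) / k * (k / T) = 1 := by field_simp
  calc (16 : ℝ) ^ (-α) * ε ^ (1 - 2 * α)
      = (16 : ℝ) ^ (-α) * ε ^ (1 - 2 * α) * (T / k * (k / T)) := by rw [hTk, mul_one]
    _ = 16 * (16 ^ (-α) * 16 ^ α) * (ε ^ (1 - 2 * α) * ε ^ (2 + 2 * α)) * (T / k) := by
        rw [← hpow]
        ring
    _ = 16 * ε ^ 3 * T / k := by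
        rw [hA, hsplit]
        ring

/-- For `ε ≤ 1/16` one has `16 ^ (-α) * ε ^ (-2 α) ≥ 16 ^ α ≥ 16`. The bound makes `r / (200 ε²)` at
most `T / 200`, so a small `M` really means leaving early. -/
theorem le_hardEps_sq_mul {α : ℝ} (hα : 1 ≤ α) {k T : ℕ} (hk : 0 < k) (hT : 0 < T)
    (hε : hardEps α k T ≤ 1 / 16) : (k : ℝ) ≤ hardEps α k T ^ 2 * T := by
  have hk' : (0 : ℝ) < k := by exact_mod_cast hk
  have h := sixteen_rpow_mul_hardEps_rpow (by linarith : 0 < α) hk hT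
  have hpos := hardEps_pos (α := α) hk hT
  generalize hardEps α k T = ε at hε h hpos ⊢
  have h1 : (16 : ℝ) ≤ 16 ^ (-α) * ε ^ (-(2 * α)) := by
    calc (16 : ℝ) = 16 ^ (1 : ℝ) := by norm_num
      _ ≤ 16 ^ α := Real.rpow_le_rpow_of_exponent_le (by norm_num) hα
      _ = 16 ^ (-α) * (1 / 16) ^ (-(2 * α)) := by
          rw [one_div, Real.inv_rpow (by norm_num), ← Real.rpow_neg (by norm_num),
            ← Real.rpow_add (by norm_num)]
          congr 1
          ring
      _ ≤ 16 ^ (-α) * ε ^ (-(2 * α)) := by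
          gcongr ?_ * ?_
          exact Real.rpow_le_rpow_of_nonpos hpos hε (by linarith)
  rw [sub_eq_add_neg, Real.rpow_add hpos, Real.rpow_one] at h
  have h2 : 16 * ε ≤ 16 * ε ^ 3 * T / k := by
    rw [← h]
    nlinarith
  rw [le_div_iff₀ hk'] at h2
  have h3 : 16 * ε * k ≤ 16 * ε * (ε ^ 2 * T) := by linarith
  exact le_of_mul_le_mul_left h3 (by positivity)

theorem tendsto_hardEps {α : ℝ} (hα : 0 < α) (k : ℕ) :
    Filter.Tendsto (hardEps α k) Filter.atTop (nhds 0) := by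
  have h1 : Filter.Tendsto (fun T : ℕ => (k : ℝ) / T) Filter.atTop (nhds 0) :=
    tendsto_const_div_atTop_nhds_zero_nat _
  have h2 := (h1.rpow_const (p := 1 / (2 + 2 * α)) (Or.inr (by positivity))).const_mul (1 / 4)
  rw [Real.zero_rpow (by positivity), mul_zero] at h2
  exact h2

end StreamingMAB

/-! ### The two cases combined -/

open StreamingMAB in
theorem theorem5 :
    ∃ c : ℝ, 0 < c ∧
      ∀ (α : ℝ) (m n k : ℕ), 1 ≤ α → 1 ≤ m → m ≤ k → k < n →
        ∃ T₀ : ℕ, ∀ T : ℕ, T₀ ≤ T →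
          ∀ A : StreamingMAB.Algorithm m n,
            ∃ ν ∈ StreamingMAB.hardFamily α n k T,
              c * (16 : ℝ) ^ (-α) *
                  ((((k : ℝ) - (m : ℝ) + 1) * (T : ℝ) ^ (1 / (α + 1))) /
                    (k : ℝ) ^ (1 + 1 / (α + 1))) *
                  StreamingMAB.gapSum α ν ≤
                StreamingMAB.expectedRegret A ν T := by
  refine ⟨1 / 16, by norm_num, fun α m n k hα hm hmk hkn => ?_⟩
  have hk : 0 < k := by omega
  have hn : 0 < n := by omega
  have hk' : (1 : ℝ) ≤ k := by exact_mod_cast hk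
  have hn' : (1 : ℝ) ≤ n := by exact_mod_cast hn
  have hmk' : (m : ℝ) ≤ k := by exact_mod_cast hmk
  have hα0 : 0 < α := by linarith
  -- This threshold keeps the means of the first `k` arms within `1/8` of `1/2`, and as `n ≥ 1` it
  -- also gives `ε ≤ 1/16`.
  have hev := ((tendsto_hardEps hα0 k).eventually_le_const
    (by positivity : (0 : ℝ) < 1 / (8 * (n + 1)))).and (Filter.eventually_gt_atTop 0)
  obtain ⟨T₀, hT₀⟩ := Filter.eventually_atTop.1 hev
  refine ⟨T₀, fun T hT A => ?_⟩
  obtain ⟨hεle, hTpos⟩ := hT₀ T hT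
  have hε := hardEps_pos (α := α) hk hTpos
  have hscale := rpow_div_rpow_eq hα0 hk hTpos
  have hrate := sixteen_rpow_mul_hardEps_rpow hα0 hk hTpos
  have hfam : ∀ i < k, ∀ tail : ℝ, (tail = 1 / 2 ∨ tail = 1) →
      (n + 1) * hardEps α k T ≤ 1 / 8 →
      hardInstance n k (hardEps α k T) tail i ∈ hardFamily α n k T :=
    fun i hi tail ht hnε => ⟨i, hi, tail, ht, coe_hardInstance hε hnε ht i⟩
  have hlong := le_hardEps_sq_mul hα hk hTpos
  rw [mul_div_assoc, hscale]
  generalize hardEps α k T = ε at hεle hε hrate hfam hlong ⊢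
  have hnε : (n + 1) * ε ≤ 1 / 8 := by
    rw [le_div_iff₀ (by positivity)] at hεle
    linarith
  have h1 : ε ≤ n * ε := le_mul_of_one_le_left hε.le hn'
  have hr : 1 ≤ (k : ℝ) - m + 1 := by linarith
  set r : ℝ := (k : ℝ) - m + 1
  have h16 : (0 : ℝ) < 16 ^ (-α) := by positivity
  set ν₀ := hardInstance n k ε (1 / 2) 0 with hν₀
  -- The constant `200` serves both cases: it makes the entropy budget `22 r / 200` small, and
  -- leaves `r / (800 ε²)` above the required `r / (1024 ε²)`.
  rcases le_total (mean A (stationary ν₀) T fun h => (earlyRounds k h : ℝ)) (r / (200 * ε ^ 2))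
    with hM | hM
  · have hdiff : ∀ i j : Fin n, j ≠ i → hardInstance n k ε (1 / 2) i j = ν₀ j := by
      intro i j hj
      have hj' : (j : ℕ) ≠ i := fun e => hj (Fin.ext e)
      simp only [hν₀, hardInstance, hardMean, hj', if_false]
      congr 1
      split_ifs <;> rfl
    have hbd : ∀ (i : ℕ) (j : Fin n), (j : ℕ) < k →
        (hardInstance n k ε (1 / 2) i j : ℝ) ∈ Set.Icc (1 / 4 : ℝ) (3 / 4) := by
      intro i j hj
      rw [coe_hardInstance hε hnε (Or.inl rfl)]
      simp only [hardMean, hj, if_true]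
      split_ifs <;> constructor <;> linarith
    obtain ⟨i, hik, hle⟩ := exists_le_expectedRegret A hm hmk hkn.le hε ν₀
      (fun i => hardInstance n k ε (1 / 2) i) hdiff (fun i hi => hbd 0 i hi)
      (fun i hi => hbd i i hi) (fun i hi => by
        rw [hν₀, coe_hardInstance hε hnε (Or.inl rfl), coe_hardInstance hε hnε (Or.inl rfl)]
        simp only [hardMean, hi, if_true]
        rw [abs_le]
        split_ifs <;> constructor <;> linarith)
      (fun i j hi hj => le_trans (by split_ifs <;> linarith)
        (gap_hardInstance_half hε hnε hi hj)) (hlong (by linarith)) hM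
    refine ⟨_, hfam i hik _ (Or.inl rfl) hnε, le_trans ?_ hle⟩
    have hsum := gapSum_hardInstance_half_le hα hkn.le hε hnε hik
    calc 1 / 16 * (16 : ℝ) ^ (-α) * (r * (1 / (16 * k * ε ^ 2))) *
          gapSum α (hardInstance n k ε (1 / 2) i)
        ≤ 1 / 16 * (16 : ℝ) ^ (-α) * (r * (1 / (16 * k * ε ^ 2))) *
          (k * ε ^ (1 - 2 * α)) := by gcongr
      _ = r / (256 * ε ^ 2) * ((16 : ℝ) ^ (-α) * ε ^ (1 - 2 * α)) := by
          field_simp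
          norm_num
      _ = ε * T * r / (16 * k) := by
          rw [hrate]
          field_simp
          norm_num
  · obtain ⟨hgap, hsum⟩ := gapSum_hardInstance_one_le hα hkn hε hnε 0
    refine ⟨_, hfam 0 hk 1 (Or.inr rfl) hnε, ?_⟩
    have hregret : 1 / 4 * (r / (200 * ε ^ 2)) ≤ expectedRegret A (hardInstance n k ε 1 0) T := by
      refine (mul_le_mul_of_nonneg_left hM (by norm_num)).trans ?_
      have hcongr : ∀ j : Fin n, (j : ℕ) < k → ν₀ j = hardInstance n k ε 1 0 j := by
        intro j hj
        simp only [hν₀, hardInstance, hardMean, hj, if_true]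
      rw [mean_earlyRounds_congr A hcongr, ← mean_const_mul, expectedRegret_eq_mean]
      exact mean_mono A _ T fun h _ => mul_earlyRounds_le_regret hgap h
    refine le_trans ?_ hregret
    have hquarter : (16 : ℝ) ^ (-α) * (1 / 4 : ℝ) ^ (1 - 2 * α) = 1 / 4 := by
      rw [show (16 : ℝ) = (1 / 4 : ℝ) ^ (-2 : ℝ) by
          rw [Real.rpow_neg (by norm_num)]
          norm_num,
        ← Real.rpow_mul (by norm_num), ← Real.rpow_add (by norm_num),
        show -2 * -α + (1 - 2 * α) = 1 by ring, Real.rpow_one]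
    calc 1 / 16 * (16 : ℝ) ^ (-α) * (r * (1 / (16 * k * ε ^ 2))) *
          gapSum α (hardInstance n k ε 1 0)
        ≤ 1 / 16 * (16 : ℝ) ^ (-α) * (r * (1 / (16 * k * ε ^ 2))) *
          (k * (1 / 4 : ℝ) ^ (1 - 2 * α)) := by gcongr
      _ = r / (256 * ε ^ 2) * ((16 : ℝ) ^ (-α) * (1 / 4 : ℝ) ^ (1 - 2 * α)) := by
          field_simp
          norm_num
      _ = r / ε ^ 2 * (1 / 1024) := by
          rw [hquarter]
          field_simp
          norm_num
      _ ≤ r / ε ^ 2 * (1 / 800) := by gcongr; norm_num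
      _ = 1 / 4 * (r / (200 * ε ^ 2)) := by
          field_simp
          norm_num
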